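/- Assume the Continuum Hypothesis, $2^{\aleph_0}=\aleph_1$. All spaces are $T_3$ (regular and $T_1$). Call a space $X$ productively Lindelöf if $X\times Y$ is Lindelöf for every Lindelöf ($T_3$) space $Y$. Then every productively Lindelöf space $X$ is Menger, i.e. for every sequence $(\mathcal U_n)_{n<\omega}$ of open covers of $X$ there are finite $\mathcal V_n\subseteq\mathcal U_n$ such that $\bigcup_{n<\omega}\mathcal V_n$ covers $X$; and hence $X$ is a D-space, i.e. whenever an open set $f(x)\ni x$ is assigned to each $x\in X$, there is a closed discrete set $D\subseteq X$ with $\bigcup_{x\in D}f(x)=X$. -/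

import Mathlib

universe u

/-- A `T₃` space `X` is productively Lindelöf if `X × Y` is Lindelöf for every Lindelöf `T₃`
space `Y`. -/
def ProductivelyLindelof (X : Type u) [TopologicalSpace X] : Prop :=
  ∀ (Y : Type u) [TopologicalSpace Y] [T3Space Y] [LindelofSpace Y], LindelofSpace (X × Y)

/-- `𝒰` is an open cover of `X`. -/
def IsOpenCovering {X : Type u} [TopologicalSpace X] (𝒰 : Set (Set X)) : Prop :=
  (∀ U ∈ 𝒰, IsOpen U) ∧ ⋃₀ 𝒰 = Set.univ

/-- `X` is Menger: from every sequence of open covers one can choose finite subfamilies which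
together cover `X`. -/
def IsMengerSpace (X : Type u) [TopologicalSpace X] : Prop :=
  ∀ 𝒰 : ℕ → Set (Set X), (∀ n, IsOpenCovering (𝒰 n)) →
    ∃ 𝒱 : ℕ → Set (Set X), (∀ n, 𝒱 n ⊆ 𝒰 n ∧ (𝒱 n).Finite) ∧ ⋃₀ (⋃ n, 𝒱 n) = Set.univ

/-- `X` is a D-space: for every open neighborhood assignment `f` there is a closed discrete
`D ⊆ X` with `⋃ {f x : x ∈ D} = X`. -/
def IsDSpace (X : Type u) [TopologicalSpace X] : Prop :=
  ∀ f : X → TopologicalSpace.Opens X, (∀ x, x ∈ f x) →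
    ∃ D : Set X, IsClosed D ∧ DiscreteTopology D ∧ ⋃ x ∈ D, (f x : Set X) = Set.univ

/-!
**Menger.** Let `X` be Lindelöf and regular. A sequence of open covers is refined by countable
cozero covers, and these are recorded by a continuous map `Φ` from `X` to the compact metrizable
space `ℕ → ℕ → [0, 1]` whose values avoid the set `E` of arrays having a row constantly equal to
`1`. A finite selection for the `n`-th cover amounts to a bound on the place of an entry `≠ 1` in
the `n`-th row, and compact sets of arrays outside `E` have such bounds in every row. Given a
dominating family of `ℵ₁` sequences of bounds, suppose that no countable part of it bounds all of
`Φ(X)`. Then there are points `x i`, `i < ω₁`, such that only countably many `Φ (x i)` lie outside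
a given open superset of `E`. Attaching to `E` an isolated point over each `Φ (x i)` yields a
Lindelöf space whose product with `X` contains an uncountable closed discrete set.

**D-space.** In a Menger space the player choosing open covers has no winning strategy in the Menger
game (Hurewicz). Aurichi's strategy for a neighborhood assignment `f` offers the covers made of the
open set `W` won so far and finitely many `f a` with `a ∉ W`; the points `a` used in a lost play
form the required closed discrete set.
-/

open Set Filter Topology TopologicalSpace
open scoped Cardinal

universe v

section MengerGame

theorem upperSemicontinuous_iff_eventually_le {X γ : Type*} [TopologicalSpace X] [LinearOrder γ]
    [SuccOrder γ] [NoMaxOrder γ] {f : X → γ} :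
    UpperSemicontinuous f ↔ ∀ x, ∀ᶠ y in 𝓝 x, f y ≤ f x :=
  ⟨fun hf x => (hf x _ (Order.lt_succ (f x))).mono fun _ => Order.le_of_lt_succ,
    fun hf x _ hc => (hf x).mono fun _ hy => hy.trans_lt hc⟩

/-- A bound for the `n`-th move of every play `g : ℕ → ℕ` in which each move `g n` stays below the
value of `h` at the history `fun i : Fin n => g i`. -/
def moveBound (h : ∀ n, (Fin n → ℕ) → ℕ) (n : ℕ) : ℕ :=
  (Fintype.piFinset fun i : Fin n => Finset.Iio (moveBound h i)).sup (h n)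

theorem lt_moveBound {h : ∀ n, (Fin n → ℕ) → ℕ} {g : ℕ → ℕ} (hg : ∀ n, g n < h n fun i => g i)
    (n : ℕ) : g n < moveBound h n := by
  induction n using Nat.strong_induction_on with
  | _ n ih =>
    rw [moveBound]
    exact (hg n).trans_le <| Finset.le_sup (f := h n) <|
      Fintype.mem_piFinset.2 fun i => Finset.mem_Iio.2 (ih i i.2)

variable {X : Type u} [TopologicalSpace X]

theorem upperSemicontinuous_moveBound {h : X → ∀ n, (Fin n → ℕ) → ℕ}
    (hh : ∀ n s, UpperSemicontinuous fun x => h x n s) (n : ℕ) :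
    UpperSemicontinuous fun x => moveBound (h x) n := by
  simp only [upperSemicontinuous_iff_eventually_le] at hh ⊢
  intro x
  induction n using Nat.strong_induction_on with
  | _ n ih =>
    let histories (y : X) := Fintype.piFinset fun i : Fin n => Finset.Iio (moveBound (h y) i)
    have hbound : ∀ᶠ y in 𝓝 x, ∀ i : Fin n, moveBound (h y) i ≤ moveBound (h x) i :=
      eventually_all.2 fun i => ih i i.2
    have hvalue : ∀ᶠ y in 𝓝 x, ∀ s ∈ histories x, h y n s ≤ h x n s :=
      (Finset.eventually_all _).2 fun s _ => hh n s x
    filter_upwards [hbound, hvalue] with y hy hys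
    have hsub : histories y ⊆ histories x :=
      Fintype.piFinset_subset _ _ fun i => Finset.Iio_subset_Iio (hy i)
    rw [moveBound, moveBound]
    exact (Finset.sup_mono hsub).trans (Finset.sup_mono_fun hys)

theorem IsMengerSpace.exists_forall_exists_le (hX : IsMengerSpace X) {p : ℕ → X → ℕ}
    (hp : ∀ n, UpperSemicontinuous (p n)) : ∃ g : ℕ → ℕ, ∀ x, ∃ n, p n x ≤ g n := by
  obtain ⟨𝒱, h𝒱, hcov⟩ := hX (fun n => range fun k => p n ⁻¹' Iio k) fun n => by
    refine ⟨forall_mem_range.2 (hp n).isOpen_preimage, eq_univ_of_forall fun x => ?_⟩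
    exact mem_sUnion_of_mem (Nat.lt_succ_self (p n x)) (mem_range_self _)
  have hbdd (n : ℕ) : ∃ b, ∀ V ∈ 𝒱 n, V ⊆ p n ⁻¹' Iio b := by
    choose! k hk using (h𝒱 n).1
    obtain ⟨b, hb⟩ := ((h𝒱 n).2.image k).bddAbove
    refine ⟨b, fun V hV => ?_⟩
    rw [← hk hV]
    exact preimage_mono (Iio_subset_Iio (hb (mem_image_of_mem k hV)))
  choose g hg using hbdd
  refine ⟨g, fun x => ?_⟩
  obtain ⟨V, hV, hxV⟩ := hcov.ge (mem_univ x)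
  obtain ⟨n, hVn⟩ := mem_iUnion.1 hV
  exact ⟨n, (hg n V hVn hxV).le⟩

/-- Hurewicz: a strategy in the Menger game, here offering after each history an increasing cover
indexed by `ℕ`, is defeated by some play. -/
theorem IsMengerSpace.exists_play_iUnion_eq_univ (hX : IsMengerSpace X)
    {U : ∀ n, (Fin n → ℕ) → ℕ → Set X} (hopen : ∀ n s k, IsOpen (U n s k))
    (hmono : ∀ n s, Monotone (U n s)) (hcov : ∀ n s, ⋃ k, U n s k = univ) :
    ∃ g : ℕ → ℕ, ⋃ n, U n (fun i => g i) (g n) = univ := by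
  let entry (x : X) (n : ℕ) (s : Fin n → ℕ) : ℕ := sInf {k | x ∈ U n s k}
  have hentry (x : X) (n : ℕ) (s : Fin n → ℕ) : x ∈ U n s (entry x n s) :=
    Nat.sInf_mem (s := {k | x ∈ U n s k}) (iUnion_eq_univ_iff.1 (hcov n s) x)
  have husc (n : ℕ) (s : Fin n → ℕ) : UpperSemicontinuous fun x => entry x n s :=
    upperSemicontinuous_iff_eventually_le.2 fun x =>
      mem_of_superset ((hopen n s _).mem_nhds (hentry x n s)) fun _ hy => Nat.sInf_le hy
  obtain ⟨g, hg⟩ := hX.exists_forall_exists_le (upperSemicontinuous_moveBound husc)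
  refine ⟨g, iUnion_eq_univ_iff.2 fun x => ?_⟩
  obtain ⟨m, hm⟩ := hg x
  obtain ⟨n, hn⟩ : ∃ n, entry x n (fun i => g i) ≤ g n := by
    by_contra! hlt
    exact (lt_moveBound hlt m).not_ge hm
  exact ⟨n, hmono n _ hn (hentry x n _)⟩

end MengerGame

section DSpace

variable {X : Type u} [TopologicalSpace X]

theorem IsMengerSpace.lindelofSpace (hX : IsMengerSpace X) : LindelofSpace X := by
  refine ⟨isLindelof_of_countable_subcover fun {ι} U hU hcov => ?_⟩
  obtain ⟨𝒱, h𝒱, h𝒱cov⟩ := hX (fun _ => range U) fun _ =>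
    ⟨forall_mem_range.2 hU, by rwa [sUnion_range, ← univ_subset_iff]⟩
  have : Countable ↥(⋃ n, 𝒱 n) := (countable_iUnion fun n => (h𝒱 n).2.countable).to_subtype
  have hindex (V : ↥(⋃ n, 𝒱 n)) : ∃ i, U i = V := by
    obtain ⟨n, hn⟩ := mem_iUnion.1 V.2
    exact (h𝒱 n).1 hn
  choose index hUindex using hindex
  refine ⟨range index, countable_range index, fun x _ => ?_⟩
  obtain ⟨V, hV, hxV⟩ := h𝒱cov.ge (mem_univ x)
  exact mem_biUnion (mem_range_self ⟨V, hV⟩) ((hUindex ⟨V, hV⟩).symm ▸ hxV)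

/-- The open set reached from `∅` by iterating `F` along the finitely many moves `s`. -/
def openStage (F : Opens X → ℕ → Opens X) : ∀ n, (Fin n → ℕ) → Opens X
  | 0, _ => ⊥
  | n + 1, s => F (openStage F n (Fin.init s)) (s (Fin.last n))

theorem IsMengerSpace.exists_iterate_iSup_eq_top (hX : IsMengerSpace X)
    {F : Opens X → ℕ → Opens X} (hmono : ∀ W, Monotone (F W)) (hcov : ∀ W, ⨆ k, F W k = ⊤) :
    ∃ (g : ℕ → ℕ) (W : ℕ → Opens X),
      W 0 = ⊥ ∧ (∀ n, W (n + 1) = F (W n) (g n)) ∧ ⨆ n, W n = ⊤ := by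
  obtain ⟨g, hg⟩ := hX.exists_play_iUnion_eq_univ
    (U := fun n s k => (F (openStage F n s) k : Set X)) (fun _ _ _ => (F _ _).isOpen)
    (fun _ _ _ _ hkl => hmono _ hkl) (fun n s => by rw [← Opens.coe_iSup, hcov, Opens.coe_top])
  refine ⟨g, fun n => openStage F n fun i => g i, rfl, fun _ => rfl, top_unique ?_⟩
  calc ⊤ ≤ ⨆ n, F (openStage F n fun i => g i) (g n) := by
        rw [← SetLike.coe_subset_coe, Opens.coe_iSup, hg, Opens.coe_top]
    _ ≤ ⨆ n, openStage F n fun i => g i :=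
        iSup_le fun n => le_iSup (fun n => openStage F n fun i => g i) (n + 1)

theorem isClosed_and_discreteTopology_of_finite_inter_nhds [T1Space X] {D : Set X}
    (hD : ∀ x, ∃ N ∈ 𝓝 x, (N ∩ D).Finite) : IsClosed D ∧ DiscreteTopology D := by
  rw [← isDiscrete_iff_discreteTopology, isClosed_and_discrete_iff]
  intro x
  obtain ⟨N, hN, hfin⟩ := hD x
  rw [disjoint_principal_right]
  filter_upwards [mem_nhdsWithin_of_mem_nhds hN, nhdsNE_le_cofinite x hfin.compl_mem_cofinite]
    with y hyN hy hyD
  exact hy ⟨hyN, hyD⟩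

theorem isClosed_and_discreteTopology_iUnion_of_disjoint [T1Space X] {W : ℕ → Opens X}
    (hmono : Monotone W) (hcov : ⨆ n, W n = ⊤) {B : ℕ → Set X} (hfin : ∀ n, (B n).Finite)
    (hdisj : ∀ n, Disjoint (B n) (W n)) :
    IsClosed (⋃ n, B n) ∧ DiscreteTopology ↥(⋃ n, B n) := by
  refine isClosed_and_discreteTopology_of_finite_inter_nhds fun x => ?_
  obtain ⟨n, hxn⟩ := Opens.mem_iSup.1 (hcov.ge (Opens.mem_top x))
  refine ⟨W n, (W n).isOpen.mem_nhds hxn, ((finite_Iio n).biUnion fun m _ => hfin m).subset ?_⟩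
  rintro y ⟨hyW, hyB⟩
  obtain ⟨m, hym⟩ := mem_iUnion.1 hyB
  refine mem_biUnion (mem_Iio.2 ?_) hym
  by_contra! hnm
  exact disjoint_left.1 (hdisj m) hym (hmono hnm hyW)

theorem exists_monotone_finite_cover_compl [LindelofSpace X] {f : X → Opens X}
    (hf : ∀ x, x ∈ f x) (W : Opens X) :
    ∃ A : ℕ → Set X, Monotone A ∧ (∀ k, (A k).Finite) ∧ (∀ k, Disjoint (A k) W) ∧
      ⨆ k, W ⊔ ⨆ a ∈ A k, f a = ⊤ := by
  obtain ⟨t, htc, htW, hcov⟩ := W.isOpen.isClosed_compl.isLindelof.elim_nhds_subcover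
    (fun x => (f x : Set X)) fun x _ => (f x).isOpen.mem_nhds (hf x)
  obtain ⟨e, he⟩ := countable_iff_exists_injOn.1 htc
  refine ⟨fun k => {a ∈ t | e a ≤ k}, fun k l hkl a ha => ⟨ha.1, ha.2.trans hkl⟩, fun k => ?_,
    fun k => disjoint_left.2 fun a ha => htW a ha.1, top_unique fun x _ => ?_⟩
  · exact ((finite_Iic k).subset (image_subset_iff.2 fun a ha => ha.2)).of_finite_image
      (he.mono fun a ha => ha.1)
  · by_cases hxW : x ∈ W
    · exact Opens.mem_iSup.2 ⟨0, Or.inl hxW⟩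
    · obtain ⟨a, ha, hxa⟩ := mem_iUnion₂.1 (hcov hxW)
      have hxsup : x ∈ ⨆ b ∈ {b ∈ t | e b ≤ e a}, f b :=
        le_iSup₂ (f := fun b (_ : b ∈ {b ∈ t | e b ≤ e a}) => f b) a ⟨ha, le_rfl⟩ hxa
      exact Opens.mem_iSup.2 ⟨e a, Or.inr hxsup⟩

theorem IsMengerSpace.isDSpace [T1Space X] (hX : IsMengerSpace X) : IsDSpace X := by
  have := hX.lindelofSpace
  intro f hf
  choose A hmono hfin hdisj hcov using exists_monotone_finite_cover_compl hf
  obtain ⟨g, W, hzero, hsucc, hWcov⟩ := hX.exists_iterate_iSup_eq_top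
    (F := fun W k => W ⊔ ⨆ a ∈ A W k, f a)
    (fun W _ _ hkl => sup_le_sup_left (biSup_mono fun _ ha => hmono W hkl ha) W) hcov
  let B (n : ℕ) : Set X := A (W n) (g n)
  have hWmono : Monotone W := monotone_nat_of_le_succ fun n => le_sup_left.trans_eq (hsucc n).symm
  obtain ⟨hclosed, hdiscrete⟩ := isClosed_and_discreteTopology_iUnion_of_disjoint hWmono hWcov
    (B := B) (fun n => hfin _ _) (fun n => hdisj _ _)
  have hWB (n : ℕ) : W n ≤ ⨆ m, ⨆ a ∈ B m, f a := by
    induction n with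
    | zero => exact hzero.trans_le bot_le
    | succ n ih => exact (hsucc n).trans_le (sup_le ih (le_iSup (fun m => ⨆ a ∈ B m, f a) n))
  refine ⟨⋃ n, B n, hclosed, hdiscrete, univ_subset_iff.1 ?_⟩
  calc univ = ((⨆ n, W n : Opens X) : Set X) := by rw [hWcov, Opens.coe_top]
    _ ⊆ ((⨆ m, ⨆ a ∈ B m, f a : Opens X) : Set X) := SetLike.coe_subset_coe.2 (iSup_le hWB)
    _ = ⋃ x ∈ ⋃ n, B n, (f x : Set X) := by simp only [Opens.coe_iSup, biUnion_iUnion]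

end DSpace

section MichaelSpace

theorem isLindelof_of_countable_diff {X : Type*} [TopologicalSpace X] {A Z : Set X}
    (hA : IsLindelof A) (hAZ : A ⊆ Z) (hZ : ∀ O, IsOpen O → A ⊆ O → (Z \ O).Countable) :
    IsLindelof Z := by
  refine isLindelof_of_countable_subcover fun U hU hcov => ?_
  obtain ⟨t, htc, htA⟩ := hA.elim_countable_subcover U hU (hAZ.trans hcov)
  have hdiff := hZ (⋃ i ∈ t, U i) (isOpen_biUnion fun i _ => hU i) htA
  obtain ⟨s, hsc, hs⟩ := hdiff.isLindelof.elim_countable_subcover U hU (sdiff_subset.trans hcov)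
  refine ⟨t ∪ s, htc.union hsc, ?_⟩
  rw [biUnion_union]
  exact sdiff_subset_iff.1 hs

/-- The Michael-type space of a set `E` and a family of points `y i`: the set `E` together with, for
each index `i`, an isolated point lying over `y i`. With `I` discrete it is realized inside
`K × OnePoint I`, where `E` sits at height `∞` and the point over `y i` at height `i`, so that its
separation properties are inherited. -/
def michaelSet {K I : Type*} (E : Set K) (y : I → K) : Set (K × OnePoint I) :=
  (fun k => (k, OnePoint.infty)) '' E ∪ range fun i => (y i, (i : OnePoint I))

theorem isLindelof_michaelSet {K I : Type*} [TopologicalSpace K] [TopologicalSpace I]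
    [DiscreteTopology I] {E : Set K} (hE : IsLindelof E) {y : I → K}
    (hy : ∀ U, IsOpen U → E ⊆ U → {i | y i ∉ U}.Countable) : IsLindelof (michaelSet E y) := by
  refine isLindelof_of_countable_diff (hE.image (f := fun k => (k, OnePoint.infty)) (by fun_prop))
    subset_union_left fun O hO hEO => ?_
  have hbox : ∀ k ∈ E, ∃ U ∈ 𝓝 k, ∃ F : Set I, F.Finite ∧
      ∀ k' ∈ U, ∀ i ∉ F, (k', (i : OnePoint I)) ∈ O := by
    intro k hk
    obtain ⟨U, hU, V, hV, hUV⟩ :=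
      mem_nhds_prod_iff.1 (hO.mem_nhds (hEO (mem_image_of_mem _ hk)))
    obtain ⟨F, hF, hFV⟩ := OnePoint.hasBasis_nhds_infty.mem_iff.1 hV
    exact ⟨U, hU, F, hF.2.finite_of_discrete, fun k' hk' i hi =>
      hUV ⟨hk', hFV (Or.inl (mem_image_of_mem _ hi))⟩⟩
  choose! U hU F hF hUF using hbox
  obtain ⟨t, htc, htE, hcov⟩ := hE.elim_nhds_subcover (fun k => interior (U k))
    fun k hk => interior_mem_nhds.2 (hU k hk)
  have hexceptional : ({i | y i ∉ ⋃ k ∈ t, interior (U k)} ∪ ⋃ k ∈ t, F k).Countable :=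
    (hy _ (isOpen_biUnion fun k _ => isOpen_interior) hcov).union
      (htc.biUnion fun k hk => (hF k (htE k hk)).countable)
  refine (hexceptional.image fun i => (y i, (i : OnePoint I))).mono ?_
  rintro z ⟨hz | ⟨i, rfl⟩, hzO⟩
  · exact (hzO (hEO hz)).elim
  · refine mem_image_of_mem _ (or_iff_not_imp_left.2 fun hi => ?_)
    obtain ⟨k, hk, hyk⟩ := mem_iUnion₂.1 (not_not.1 hi)
    by_contra hiF
    exact hzO (hUF k (htE k hk) _ (interior_subset hyk) i fun h => hiF (mem_biUnion hk h))

end MichaelSpace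

section ProductivelyLindelof

variable {X : Type u} [TopologicalSpace X]

theorem ProductivelyLindelof.lindelofSpace_prod (hX : ProductivelyLindelof X) (Y : Type*)
    [Small.{u} Y] [TopologicalSpace Y] [T3Space Y] [LindelofSpace Y] : LindelofSpace (X × Y) := by
  let e : Y ≃ₜ Shrink.{u} Y := Shrink.homeomorph Y
  have : T3Space (Shrink.{u} Y) := e.symm.isEmbedding.t3Space
  have : LindelofSpace (Shrink.{u} Y) := e.symm.isClosedEmbedding.LindelofSpace
  have := hX (Shrink.{u} Y)
  exact ((Homeomorph.refl X).prodCongr e).isClosedEmbedding.LindelofSpace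

theorem ProductivelyLindelof.lindelofSpace (hX : ProductivelyLindelof X) : LindelofSpace X :=
  have := hX.lindelofSpace_prod Unit
  (Homeomorph.prodUnique X Unit).symm.isClosedEmbedding.LindelofSpace

theorem ProductivelyLindelof.countable_index (hX : ProductivelyLindelof X) {K I : Type*}
    [Small.{u} K] [Small.{u} I] [TopologicalSpace K] [T3Space K] {E : Set K} (hE : IsLindelof E)
    {Φ : X → K} (hΦ : Continuous Φ) (hΦE : ∀ x, Φ x ∉ E) (x : I → X)
    (hx : ∀ U, IsOpen U → E ⊆ U → {i | Φ (x i) ∉ U}.Countable) : Countable I := by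
  let _ : TopologicalSpace I := ⊥
  have : DiscreteTopology I := ⟨rfl⟩
  have : Small.{u} (OnePoint I) := small_map (Equiv.optionEquivSumPUnit I)
  let Z := michaelSet E (Φ ∘ x)
  have : LindelofSpace Z := isLindelof_iff_lindelofSpace.1 (isLindelof_michaelSet hE hx)
  have := hX.lindelofSpace_prod Z
  let graph : Set (X × Z) := {p | Φ p.1 = p.2.1.1}
  have hgraph : IsClosed graph := isClosed_eq (by fun_prop) (by fun_prop)
  let level (i : I) : Set (X × Z) := {p | p.2.1.2 = (i : OnePoint I)}
  have hlevel (i : I) : IsOpen (level i) := by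
    have hi : IsOpen {(i : OnePoint I)} := by
      simpa using OnePoint.isOpen_image_coe.2 (isOpen_discrete {i})
    exact hi.preimage (by fun_prop)
  have hcov : graph ⊆ ⋃ i, level i := by
    rintro ⟨a, ⟨_, ⟨k, hk, rfl⟩ | ⟨i, rfl⟩⟩⟩ hp
    · exact (hΦE a (mem_of_eq_of_mem hp hk)).elim
    · exact mem_iUnion.2 ⟨i, rfl⟩
  obtain ⟨t, htc, ht⟩ := hgraph.isLindelof.elim_countable_subcover level hlevel hcov
  refine countable_univ_iff.1 (htc.mono fun i _ => ?_)
  let p : X × Z := (x i, ⟨(Φ (x i), i), Or.inr (mem_range_self i)⟩)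
  obtain ⟨j, hj, hij⟩ := mem_iUnion₂.1 (ht (show p ∈ graph from rfl))
  rwa [OnePoint.coe_injective hij]

theorem ProductivelyLindelof.exists_forall_exists_le_mem (hX : ProductivelyLindelof X)
    {K I : Type*} [Small.{u} K] [Small.{u} I] [TopologicalSpace K] [T3Space K] [LinearOrder I]
    [Uncountable I] (hI : ∀ i : I, (Iic i).Countable) {E : Set K} (hE : IsLindelof E) {Φ : X → K}
    (hΦ : Continuous Φ) (hΦE : ∀ x, Φ x ∉ E) {B : I → Set K}
    (hB : ∀ O, IsOpen O → E ⊆ O → ∃ i, Oᶜ ⊆ B i) : ∃ i, ∀ x, ∃ j ≤ i, Φ x ∈ B j := by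
  by_contra! hescape
  choose x hx using hescape
  refine not_countable (hX.countable_index hE hΦ hΦE x fun O hO hEO => ?_)
  obtain ⟨j, hj⟩ := hB O hO hEO
  refine (hI j).mono fun i hi => ?_
  by_contra hij
  exact hx i j (not_le.1 hij).le (hj hi)

end ProductivelyLindelof

section Menger

theorem exists_cofinal_family_of_cof_le_aleph_one {α : Type v} [Preorder α] [Nonempty α]
    (hα : Order.cof α ≤ ℵ₁) :
    ∃ (I : Type v) (_ : LinearOrder I) (e : I → α),
      Uncountable I ∧ (∀ i : I, (Iic i).Countable) ∧ IsCofinal (range e) := by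
  obtain ⟨s, hs, hcard⟩ := Order.exists_cof_eq α
  have hI : #(ℵ₁ : Cardinal.{v}).ord.ToType = ℵ₁ := Cardinal.mk_ord_toType _
  obtain ⟨f⟩ : #s ≤ #(ℵ₁ : Cardinal.{v}).ord.ToType := by rw [hI, hcard]; exact hα
  have := hs.nonempty.to_subtype
  have hsurj : Function.Surjective (Function.invFun f) := Function.invFun_surjective f.injective
  refine ⟨_, inferInstance, Subtype.val ∘ Function.invFun f, ?_, fun i => ?_, ?_⟩
  · rw [← Cardinal.aleph0_lt_mk_iff, hI]
    exact Cardinal.aleph0_lt_aleph_one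
  · rw [← Cardinal.le_aleph0_iff_set_countable, ← Cardinal.lt_aleph_one_iff]
    exact (Cardinal.mk_Iic_lt i (by simp) (by simp)).trans_eq hI
  · rwa [hsurj.range_comp, Subtype.range_coe]

/-- The arrays whose `n`-th row, for every `n`, has an entry other than `1` at some place
`k ≤ b n`. -/
def boundedRows (b : ℕ → ℕ) : Set (ℕ → ℕ → unitInterval) := {z | ∀ n, ∃ k ≤ b n, z n k ≠ 1}

theorem boundedRows_mono : Monotone boundedRows := fun _ _ hbc _ hz n =>
  (hz n).imp fun _ hk => ⟨hk.1.trans (hbc n), hk.2⟩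

theorem exists_subset_boundedRows {C : Set (ℕ → ℕ → unitInterval)} (hC : IsCompact C)
    (hne : ∀ z ∈ C, ∀ n, ∃ k, z n k ≠ 1) : ∃ b, C ⊆ boundedRows b := by
  have hrow (n : ℕ) : ∃ b, ∀ z ∈ C, ∃ k ≤ b, z n k ≠ 1 := by
    obtain ⟨t, ht⟩ := hC.elim_finite_subcover
      (fun k : ℕ => {z : ℕ → ℕ → unitInterval | z n k ≠ 1})
      (fun k => isOpen_ne_fun (by fun_prop) continuous_const)
      fun z hz => mem_iUnion.2 (hne z hz n)
    obtain ⟨b, hb⟩ := t.bddAbove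
    refine ⟨b, fun z hz => ?_⟩
    obtain ⟨k, hk, hzk⟩ := mem_iUnion₂.1 (ht hz)
    exact ⟨k, hb hk, hzk⟩
  choose b hb using hrow
  exact ⟨b, fun z hz n => hb n z hz⟩

variable {X : Type u} [TopologicalSpace X]

theorem ProductivelyLindelof.exists_seq_mem_boundedRows (h𝔡 : Order.cof (ℕ → ℕ) ≤ ℵ₁)
    (hX : ProductivelyLindelof X) {Φ : X → ℕ → ℕ → unitInterval} (hΦ : Continuous Φ)
    (hne : ∀ x n, ∃ k, Φ x n k ≠ 1) :
    ∃ b : ℕ → ℕ → ℕ, ∀ x, ∃ i, Φ x ∈ boundedRows (b i) := by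
  obtain ⟨I, _, e, _, hI, he⟩ := exists_cofinal_family_of_cof_le_aleph_one h𝔡
  let E : Set (ℕ → ℕ → unitInterval) := {z | ¬ ∀ n, ∃ k, z n k ≠ 1}
  have hB (O : Set (ℕ → ℕ → unitInterval)) (hO : IsOpen O) (hEO : E ⊆ O) :
      ∃ i, Oᶜ ⊆ boundedRows (e i) := by
    obtain ⟨b, hb⟩ := exists_subset_boundedRows hO.isClosed_compl.isCompact fun z hz =>
      by_contra fun h => hz (hEO h)
    obtain ⟨_, ⟨i, rfl⟩, hbi⟩ := he b
    exact ⟨i, hb.trans (boundedRows_mono hbi)⟩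
  obtain ⟨i, hi⟩ := hX.exists_forall_exists_le_mem hI (HereditarilyLindelofSpace.isLindelof E) hΦ
    (fun x h => h (hne x)) hB
  obtain ⟨a, ha⟩ := (hI i).exists_eq_range ⟨i, self_mem_Iic⟩
  refine ⟨fun n => e (a n), fun x => ?_⟩
  obtain ⟨j, hj, hxj⟩ := hi x
  obtain ⟨n, rfl⟩ := ha.le hj
  exact ⟨n, hxj⟩

theorem exists_cozero_refinement [RegularSpace X] [LindelofSpace X] [Nonempty X]
    {𝒰 : Set (Set X)} (h𝒰 : IsOpenCovering 𝒰) :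
    ∃ φ : X → ℕ → unitInterval, Continuous φ ∧ (∀ k, ∃ U ∈ 𝒰, ∀ x, φ x k ≠ 1 → x ∈ U) ∧
      ∀ x, ∃ k, φ x k ≠ 1 := by
  have hlocal (x : X) : ∃ U ∈ 𝒰, ∃ f : X → unitInterval, Continuous f ∧ f x ≠ 1 ∧
      ∀ y, f y ≠ 1 → y ∈ U := by
    obtain ⟨U, hU, hxU⟩ := h𝒰.2.ge (mem_univ x)
    obtain ⟨f, hf, hfx, hfU⟩ := CompletelyRegularSpace.completely_regular x Uᶜ
      (h𝒰.1 U hU).isClosed_compl (not_not.2 hxU)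
    exact ⟨U, hU, f, hf, by simp [hfx], fun y hy => by_contra fun h => hy (hfU h)⟩
  choose U hU f hf hfx hfU using hlocal
  obtain ⟨t, htc, ht⟩ := LindelofSpace.elim_nhds_subcover (fun x => {y | f x y ≠ 1}) fun x =>
    (isOpen_ne_fun (hf x) continuous_const).mem_nhds (hfx x)
  have hne : t.Nonempty := nonempty_iff_ne_empty.2 fun h => empty_ne_univ (by simpa [h] using ht)
  obtain ⟨a, rfl⟩ := htc.exists_eq_range hne
  exact ⟨fun x k => f (a k) x, continuous_pi fun k => hf _, fun k => ⟨U (a k), hU _, hfU _⟩,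
    fun x => by simpa using ht.ge (mem_univ x)⟩

theorem exists_finite_selection_of_mem_boundedRows {X : Type*} {𝒰 : ℕ → Set (Set X)}
    {Φ : X → ℕ → ℕ → unitInterval} (hΦ : ∀ n k, ∃ U ∈ 𝒰 n, ∀ x, Φ x n k ≠ 1 → x ∈ U)
    {b : ℕ → ℕ → ℕ} (hb : ∀ x, ∃ i, Φ x ∈ boundedRows (b i)) :
    ∃ 𝒱 : ℕ → Set (Set X), (∀ n, 𝒱 n ⊆ 𝒰 n ∧ (𝒱 n).Finite) ∧ ⋃₀ (⋃ n, 𝒱 n) = univ := by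
  choose U hU hΦU using hΦ
  refine ⟨fun n => U n '' Iic (b n n), fun n => ⟨?_, (finite_Iic _).image _⟩,
    eq_univ_of_forall fun x => ?_⟩
  · exact image_subset_iff.2 fun k _ => hU n k
  · obtain ⟨i, hi⟩ := hb x
    obtain ⟨k, hk, hxk⟩ := hi i
    exact ⟨U i k, mem_iUnion.2 ⟨i, mem_image_of_mem _ hk⟩, hΦU i k x hxk⟩

theorem ProductivelyLindelof.isMengerSpace [RegularSpace X] (h𝔡 : Order.cof (ℕ → ℕ) ≤ ℵ₁)
    (hX : ProductivelyLindelof X) : IsMengerSpace X := by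
  intro 𝒰 h𝒰
  have := hX.lindelofSpace
  rcases isEmpty_or_nonempty X with hempty | hnonempty
  · exact ⟨fun _ => ∅, by simp, Subsingleton.elim _ _⟩
  choose φ hφ hφ𝒰 hne using fun n => exists_cozero_refinement (h𝒰 n)
  obtain ⟨b, hb⟩ := hX.exists_seq_mem_boundedRows h𝔡 (Φ := fun x n => φ n x) (continuous_pi hφ)
    fun x n => hne n x
  exact exists_finite_selection_of_mem_boundedRows hφ𝒰 hb

end Menger

/-- The hypothesis says `𝔡 ≤ ℵ₁`, since closing a family of functions under finite modifications
turns eventual domination into domination everywhere. -/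
theorem mainTheorem2_general (h𝔡 : Order.cof (ℕ → ℕ) ≤ ℵ₁) (X : Type u) [TopologicalSpace X]
    [T3Space X] (hX : ProductivelyLindelof X) : IsMengerSpace X ∧ IsDSpace X :=
  have hMenger := hX.isMengerSpace h𝔡
  ⟨hMenger, hMenger.isDSpace⟩

theorem mainTheorem2 (CH : Cardinal.aleph.{0} 1 = Cardinal.continuum.{0})
    (X : Type u) [TopologicalSpace X] [T3Space X] (hX : ProductivelyLindelof X) :
    IsMengerSpace X ∧ IsDSpace X := by
  have h𝔡 : Order.cof (ℕ → ℕ) ≤ ℵ₁ := (Order.cof_le_cardinalMk _).trans (by simp [CH])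
  exact mainTheorem2_general h𝔡 X hX
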